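/- Let $G=(V,E)$ be a finite simple graph with $n=|V|$ vertices and $m=|E|$ edges. A vertex labeling $\gamma=(v_1,\dots,v_n)$ of $G$, that is, an enumeration of $V$ without repetition, is called \emph{non-jumping} if, for all indices $i<j<k<l$ with $(v_i,v_k)\in E$ and $(v_j,v_l)\in E$, also $(v_j,v_k)\in E$. \textbf{Theorem.} Given a graph $G=(V,E)$ by its adjacency lists (in arbitrary order), together with a vertex labeling $\gamma$ of $G$, it can be determined in $O(|V|\log|V|+|E|)$ time whether $\gamma$ is a non-jumping labeling for $G$. Here time is the number of steps of a random access machine whose instructions (assignment of constants, copying, addition, truncated subtraction, indirect load and store, jumps and conditional jumps on $<$ and $=$) cost one step each. Precisely: there are one program and one constant $C\in\mathbb N$ such that on every such input the program halts after at most $C\,(n\log n+m+1)$ steps with output $1$ if $\gamma$ is non-jumping and output $0$ otherwise, and all numbers stored in registers and memory during the computation are at most $(n+2)^C$, so that they fit into words of $O(\log (n+2))$ bits. -/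

import Mathlib

universe u

/-- A vertex labeling `v₁, …, vₙ` of the vertex set `V` (here `γ : Fin n ≃ V`, with labels counted
from `0`) is a *non-jumping labeling* of the graph `G` if, whenever `i < j < k < l` and both
`(vᵢ, vₖ)` and `(vⱼ, vₗ)` are edges, `(vⱼ, vₖ)` is an edge. -/
def IsNonJumpingLabeling {V : Type u} {n : ℕ} (G : SimpleGraph V) (γ : Fin n ≃ V) : Prop :=
  ∀ i j k l : Fin n, i < j → j < k → k < l →
    G.Adj (γ i) (γ k) → G.Adj (γ j) (γ l) → G.Adj (γ j) (γ k)

/-- `adj` is an adjacency-list representation of `G`: the list `adj v` contains every neighbour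
of `v` exactly once, in an arbitrary order, and nothing else. -/
def IsAdjacencyList {V : Type u} (G : SimpleGraph V) (adj : V → List V) : Prop :=
  ∀ v, (adj v).Nodup ∧ ∀ w, w ∈ adj v ↔ G.Adj v w

/-! ### Random access machines

A random access machine has registers `0, 1, 2, …` (a program mentions only finitely many of them)
and a memory with cells `0, 1, 2, …`, all of them holding natural numbers. Memory is addressed
indirectly, through the contents of a register. There is no multiplication or division. -/
namespace RAM

/-- The instructions. Arguments named `d`, `a`, `b` are register numbers, `t` is a position in the
program. -/
inductive Instr
  /-- `reg d := c` -/
  | const (d c : ℕ)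
  /-- `reg d := reg a` -/
  | move (d a : ℕ)
  /-- `reg d := reg a + reg b` -/
  | add (d a b : ℕ)
  /-- `reg d := max (reg a - reg b) 0` -/
  | sub (d a b : ℕ)
  /-- `reg d := mem (reg a)` -/
  | load (d a : ℕ)
  /-- `mem (reg a) := reg b` -/
  | store (a b : ℕ)
  /-- go to `t` -/
  | jump (t : ℕ)
  /-- go to `t` if `reg a < reg b` -/
  | jumpLt (a b t : ℕ)
  /-- go to `t` if `reg a = reg b` -/
  | jumpEq (a b t : ℕ)

/-- A program is a finite list of instructions, fixed once and for all for inputs of all sizes. -/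
abbrev Program := List Instr

/-- A configuration: program counter, registers, memory. -/
structure Config where
  pc : ℕ
  reg : ℕ → ℕ
  mem : ℕ → ℕ

/-- The effect of one instruction. -/
def Instr.exec (c : Config) : Instr → Config
  | .const d x => { c with pc := c.pc + 1, reg := Function.update c.reg d x }
  | .move d a => { c with pc := c.pc + 1, reg := Function.update c.reg d (c.reg a) }
  | .add d a b => { c with pc := c.pc + 1, reg := Function.update c.reg d (c.reg a + c.reg b) }
  | .sub d a b => { c with pc := c.pc + 1, reg := Function.update c.reg d (c.reg a - c.reg b) }
  | .load d a => { c with pc := c.pc + 1, reg := Function.update c.reg d (c.mem (c.reg a)) }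
  | .store a b => { c with pc := c.pc + 1, mem := Function.update c.mem (c.reg a) (c.reg b) }
  | .jump t => { c with pc := t }
  | .jumpLt a b t => { c with pc := if c.reg a < c.reg b then t else c.pc + 1 }
  | .jumpEq a b t => { c with pc := if c.reg a = c.reg b then t else c.pc + 1 }

/-- The machine has halted when the program counter has left the program. -/
def Halted (p : Program) (c : Config) : Prop := p.length ≤ c.pc

/-- One step, of cost one: execute the current instruction; a halted machine stays as it is. -/
def step (p : Program) (c : Config) : Config :=
  match p[c.pc]? with
  | none => c
  | some i => i.exec c

/-- The initial configuration: the input is stored in the cells `0, 1, …` of the memory, all other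
cells and all registers hold `0`, and execution starts at the first instruction. -/
def init (input : List ℕ) : Config where
  pc := 0
  reg := fun _ => 0
  mem := fun a => input.getD a 0

/-- The configuration after `s` steps on the given input. -/
def run (p : Program) (input : List ℕ) (s : ℕ) : Config := (step p)^[s] (init input)

/-- All registers and all memory cells hold numbers of at most `W`. -/
def Config.BoundedBy (c : Config) (W : ℕ) : Prop := (∀ d, c.reg d ≤ W) ∧ ∀ a, c.mem a ≤ W

/-- On the given input the program halts after `t` steps with output `out` in register `0`, and up
to then no register and no memory cell ever holds a number larger than `W`. -/
def Computes (p : Program) (input : List ℕ) (out t W : ℕ) : Prop :=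
  Halted p (run p input t) ∧ (run p input t).reg 0 = out ∧
    ∀ s ≤ t, (run p input s).BoundedBy W

end RAM

/-- The input for the machine. The vertex set `V` has `n` elements, which the machine knows by the
identifiers `0, …, n - 1`; `name x` is the vertex with identifier `x`. The input consists of, one
after the other: the number `n`; the identifiers of the vertices in the order of the labeling `γ`;
the lengths of the `n` adjacency lists, in the order of the identifiers; the `n` adjacency lists, in
the order of the identifiers. -/
def encodeInput {V : Type u} {n : ℕ} (name γ : Fin n ≃ V) (adj : V → List V) : List ℕ :=
  [n] ++ List.ofFn (fun i => (name.symm (γ i) : ℕ))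
    ++ List.ofFn (fun x => (adj (name x)).length)
    ++ (List.ofFn fun x => (adj (name x)).map fun w => (name.symm w : ℕ)).flatten

/-! Call `k` bad if there are `i < j < k < l` with `k` adjacent to `i`, `j` adjacent to `l`, and `j`
not adjacent to `k`. The labeling is non-jumping iff no position is bad. For fixed `k` and `j < k`,
suitable `i` and `l` exist iff the smallest neighbour of `k` is below `j` and the largest neighbour
of `j` is above `k`.

The algorithm treats `k = 1, …, n` in turn. It scans the adjacency list of `k`, stamps each
neighbour with `k` (so marks never need clearing) and records the extreme neighbours
(`scanCmd_spec`). It then walks down a linked list of earlier positions, in decreasing order, as far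
as the smallest neighbour (`walkCmd_spec`). A node `j` whose largest neighbour is at most `k` is
deleted, being useless now and later. Any other node must be a neighbour of `k`, or else `k` is bad
and the walk stops. Finally `k` is put in front.

Each visited node is thus deleted, or charged to an edge at `k`, or ends the walk. With the length
of the list as potential, the total time is `O(n + m)`; this is the inequality inside `Invariant`,
preserved by `visitCmd_spec`. The stated bound follows from `n ≤ n log n + 1`.

The program is written in a small structured language. Weakest-precondition rules for its compiled
code track correctness, exact step counts and word size together; `Cmd.WP.computes` returns to the
machine. -/

namespace RAM

/-! ### Structured programs for the random access machine -/

/-- Straight-line instructions. -/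
inductive Op
  | const (d c : ℕ)
  | move (d a : ℕ)
  | add (d a b : ℕ)
  | load (d a : ℕ)
  | store (a b : ℕ)

/-- Registers and memory, together with the number of steps made so far. -/
structure State where
  reg : ℕ → ℕ
  mem : ℕ → ℕ
  time : ℕ

/-- The machine instruction of a straight-line instruction. -/
def Op.instr : Op → Instr
  | .const d c => .const d c
  | .move d a => .move d a
  | .add d a b => .add d a b
  | .load d a => .load d a
  | .store a b => .store a b

/-- The effect of a straight-line instruction. -/
def Op.eval (s : State) : Op → State
  | .const d c => ⟨Function.update s.reg d c, s.mem, s.time + 1⟩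
  | .move d a => ⟨Function.update s.reg d (s.reg a), s.mem, s.time + 1⟩
  | .add d a b => ⟨Function.update s.reg d (s.reg a + s.reg b), s.mem, s.time + 1⟩
  | .load d a => ⟨Function.update s.reg d (s.mem (s.reg a)), s.mem, s.time + 1⟩
  | .store a b => ⟨s.reg, Function.update s.mem (s.reg a) (s.reg b), s.time + 1⟩

/-- The instruction produces no number above `W`, provided there was none before. -/
def Op.Safe (W : ℕ) (s : State) : Op → Prop
  | .const _ c => c ≤ W
  | .add _ a b => s.reg a + s.reg b ≤ W
  | _ => True

/-- Structured programs. -/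
inductive Cmd
  | block (ops : List Op)
  | seq (c₁ c₂ : Cmd)
  | ifLt (a b : ℕ) (c₁ c₂ : Cmd)
  | whileLt (a b : ℕ) (c : Cmd)

/-- The length of the compiled program. -/
def Cmd.size : Cmd → ℕ
  | .block ops => ops.length
  | .seq c₁ c₂ => c₁.size + c₂.size
  | .ifLt _ _ c₁ c₂ => 2 + c₂.size + c₁.size
  | .whileLt _ _ c => 3 + c.size

/-- The machine program of a structured program, to be placed at position `l`. -/
def Cmd.code : Cmd → ℕ → Program
  | .block ops, _ => ops.map Op.instr
  | .seq c₁ c₂, l => c₁.code l ++ c₂.code (l + c₁.size)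
  | .ifLt a b c₁ c₂, l =>
      [.jumpLt a b (l + 2 + c₂.size)] ++ c₂.code (l + 1) ++ [.jump (l + 2 + c₂.size + c₁.size)]
        ++ c₁.code (l + 2 + c₂.size)
  | .whileLt a b c, l =>
      [.jumpLt a b (l + 2), .jump (l + 3 + c.size)] ++ c.code (l + 2) ++ [.jump l]

theorem Cmd.length_code (c : Cmd) (l : ℕ) : (c.code l).length = c.size := by
  induction c generalizing l with
  | block ops => simp [code, size]
  | seq c₁ c₂ h₁ h₂ => simp [code, size, h₁, h₂]
  | ifLt a b c₁ c₂ h₁ h₂ => simp [code, size, h₁, h₂]; omega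
  | whileLt a b c h => simp [code, size, h]; omega

/-! ### Execution of code placed inside a larger program -/

/-- The configuration with a given state and program counter. -/
def State.toConfig (s : State) (l : ℕ) : Config := ⟨l, s.reg, s.mem⟩

/-- Let one time step pass. -/
def State.tick (s : State) : State := ⟨s.reg, s.mem, s.time + 1⟩

/-- All registers and memory cells hold numbers of at most `W`. -/
def State.Bounded (W : ℕ) (s : State) : Prop := (∀ d, s.reg d ≤ W) ∧ ∀ a, s.mem a ≤ W

/-- In program `p`, state `s` at position `l` leads to state `s'` at position `l'`, the clock
running correctly, and without numbers above `W`. -/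
def Reaches (p : Program) (W : ℕ) (s : State) (l : ℕ) (s' : State) (l' : ℕ) : Prop :=
  ∃ t, s'.time = s.time + t ∧ (step p)^[t] (s.toConfig l) = s'.toConfig l' ∧
    ∀ u ≤ t, ((step p)^[u] (s.toConfig l)).BoundedBy W

theorem Reaches.refl {p : Program} {W : ℕ} {s : State} {l : ℕ} (h : s.Bounded W) :
    Reaches p W s l s l :=
  ⟨0, rfl, rfl, fun u hu => by obtain rfl : u = 0 := by omega
                               exact h⟩

theorem Reaches.bounded {p : Program} {W : ℕ} {s s' : State} {l l' : ℕ}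
    (h : Reaches p W s l s' l') : s'.Bounded W := by
  obtain ⟨t, -, h2, h3⟩ := h
  have := h3 t le_rfl
  rw [h2] at this
  exact this

theorem Reaches.trans {p : Program} {W : ℕ} {s₁ s₂ s₃ : State} {l₁ l₂ l₃ : ℕ}
    (h : Reaches p W s₁ l₁ s₂ l₂) (h' : Reaches p W s₂ l₂ s₃ l₃) : Reaches p W s₁ l₁ s₃ l₃ := by
  obtain ⟨t, ht, hs, hb⟩ := h
  obtain ⟨t', ht', hs', hb'⟩ := h'
  refine ⟨t' + t, by omega, by rw [Function.iterate_add_apply, hs, hs'], fun u hu => ?_⟩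
  rcases le_total u t with h1 | h1
  · exact hb u h1
  · obtain ⟨v, rfl⟩ := Nat.exists_eq_add_of_le' h1
    rw [Function.iterate_add_apply, hs]
    exact hb' v (by omega)

theorem Reaches.of_step {p : Program} {W : ℕ} {s s' : State} {l l' : ℕ}
    (hs : s.Bounded W) (hs' : s'.Bounded W) (ht : s'.time = s.time + 1)
    (h : step p (s.toConfig l) = s'.toConfig l') : Reaches p W s l s' l' := by
  refine ⟨1, ht, h, fun u hu => ?_⟩
  interval_cases u
  · exact hs
  · change (step p (s.toConfig l)).BoundedBy W
    rw [h]
    exact hs'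

theorem step_append (pre post : Program) (i : Instr) (s : State) :
    step (pre ++ i :: post) (s.toConfig pre.length) = i.exec (s.toConfig pre.length) := by
  simp [step, State.toConfig]

theorem Reaches.jump {pre post : Program} {W : ℕ} {s : State} (hs : s.Bounded W) (l' : ℕ) :
    Reaches (pre ++ .jump l' :: post) W s pre.length s.tick l' :=
  .of_step hs hs rfl (step_append _ _ _ _)

theorem Reaches.jumpLt {pre post : Program} {W : ℕ} {s : State} (hs : s.Bounded W) (a b l' : ℕ) :
    Reaches (pre ++ .jumpLt a b l' :: post) W s pre.length s.tick
      (if s.reg a < s.reg b then l' else pre.length + 1) :=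
  .of_step hs hs rfl (step_append _ _ _ _)

theorem Op.bounded_eval {W : ℕ} {s : State} (hs : s.Bounded W) {o : Op} (h : o.Safe W s) :
    (o.eval s).Bounded W := by
  have key : ∀ (f : ℕ → ℕ) (d x : ℕ), (∀ d, f d ≤ W) → x ≤ W →
      ∀ e, Function.update f d x e ≤ W := by
    intro f d x hf hx e
    rw [Function.update_apply]
    split_ifs
    exacts [hx, hf e]
  cases o with
  | const d c => exact ⟨key _ _ _ hs.1 h, hs.2⟩
  | move d a => exact ⟨key _ _ _ hs.1 (hs.1 a), hs.2⟩
  | add d a b => exact ⟨key _ _ _ hs.1 h, hs.2⟩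
  | load d a => exact ⟨key _ _ _ hs.1 (hs.2 _), hs.2⟩
  | store a b => exact ⟨hs.1, key _ _ _ hs.2 (hs.1 b)⟩

theorem Reaches.op {pre post : Program} {W : ℕ} {s : State} (hs : s.Bounded W) {o : Op}
    (h : o.Safe W s) :
    Reaches (pre ++ o.instr :: post) W s pre.length (o.eval s) (pre.length + 1) := by
  refine .of_step hs (o.bounded_eval hs h) ?_ ?_
  · cases o <;> rfl
  · rw [step_append]
    cases o <;> rfl

/-! ### Weakest-precondition rules -/

/-- Started in state `s`, the program `c` halts in a state satisfying `Q`, without producing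
numbers above `W`. -/
def Cmd.WP (W : ℕ) (c : Cmd) (Q : State → Prop) (s : State) : Prop :=
  ∀ pre post : Program, s.Bounded W → ∃ s', Q s' ∧
    Reaches (pre ++ (c.code pre.length ++ post)) W s pre.length s' (pre.length + c.size)

/-- The weakest precondition of straight-line code. -/
def opsWP (W : ℕ) : List Op → (State → Prop) → State → Prop
  | [], Q, s => Q s
  | o :: ops, Q, s => o.Safe W s ∧ opsWP W ops Q (o.eval s)

theorem Cmd.WP.mono {W : ℕ} {c : Cmd} {Q R : State → Prop} {s : State} (h : c.WP W Q s)
    (hQ : ∀ s, Q s → R s) : c.WP W R s := by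
  intro pre post hs
  obtain ⟨s', h1, h2⟩ := h pre post hs
  exact ⟨s', hQ _ h1, h2⟩

theorem Cmd.WP.block {W : ℕ} {ops : List Op} {Q : State → Prop} {s : State}
    (h : opsWP W ops Q s) : (Cmd.block ops).WP W Q s := by
  intro pre post hs
  induction ops generalizing pre s with
  | nil => exact ⟨s, h, .refl hs⟩
  | cons o ops ih =>
    obtain ⟨s', h1, h2⟩ := ih h.2 (pre ++ [o.instr]) (o.bounded_eval hs h.1)
    refine ⟨s', h1, .trans (.op hs h.1) ?_⟩
    simp only [code, size, List.map_cons, List.length_append, List.length_cons, List.length_nil,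
      List.append_assoc, List.cons_append, List.nil_append, zero_add] at h2 ⊢
    rw [Nat.add_assoc, Nat.add_comm 1] at h2
    exact h2

theorem Cmd.WP.seq {W : ℕ} {c₁ c₂ : Cmd} {Q : State → Prop} {s : State}
    (h : c₁.WP W (c₂.WP W Q) s) : (Cmd.seq c₁ c₂).WP W Q s := by
  intro pre post hs
  obtain ⟨s₁, h1, h2⟩ := h pre (c₂.code (pre.length + c₁.size) ++ post) hs
  obtain ⟨s₂, h3, h4⟩ := h1 (pre ++ c₁.code pre.length) post h2.bounded
  refine ⟨s₂, h3, .trans (s₂ := s₁) (l₂ := pre.length + c₁.size) ?_ ?_⟩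
  · simpa [code] using h2
  · simpa [code, size, length_code, Nat.add_assoc] using h4

/-- The branches are asymmetric because the code of `c₂` comes first and must jump over that of
`c₁`; this is its additional tick. -/
theorem Cmd.WP.ifLt {W : ℕ} {a b : ℕ} {c₁ c₂ : Cmd} {Q : State → Prop} {s : State}
    (h₁ : s.reg a < s.reg b → c₁.WP W Q s.tick)
    (h₂ : ¬ s.reg a < s.reg b → c₂.WP W (fun s' => Q s'.tick) s.tick) :
    (Cmd.ifLt a b c₁ c₂).WP W Q s := by
  intro pre post hs
  have hj := Reaches.jumpLt (pre := pre) (post := c₂.code (pre.length + 1) ++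
    ([.jump (pre.length + 2 + c₂.size + c₁.size)] ++ (c₁.code (pre.length + 2 + c₂.size) ++ post)))
    hs a b (pre.length + 2 + c₂.size)
  by_cases hlt : s.reg a < s.reg b
  · obtain ⟨s', h1, h2⟩ := h₁ hlt (pre ++ [.jumpLt a b (pre.length + 2 + c₂.size)] ++
      c₂.code (pre.length + 1) ++ [.jump (pre.length + 2 + c₂.size + c₁.size)]) post hs
    have hl : (pre ++ [Instr.jumpLt a b (pre.length + 2 + c₂.size)] ++
      c₂.code (pre.length + 1) ++ [Instr.jump (pre.length + 2 + c₂.size + c₁.size)]).length =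
        pre.length + 2 + c₂.size := by
      simp [length_code]; omega
    rw [hl] at h2
    rw [if_pos hlt] at hj
    refine ⟨s', h1, .trans (s₂ := s.tick) (l₂ := pre.length + 2 + c₂.size) ?_ ?_⟩
    · simpa [code] using hj
    · simpa [code, size, Nat.add_assoc] using h2
  · obtain ⟨s', h1, h2⟩ := h₂ hlt (pre ++ [.jumpLt a b (pre.length + 2 + c₂.size)])
      ([.jump (pre.length + 2 + c₂.size + c₁.size)] ++
        (c₁.code (pre.length + 2 + c₂.size) ++ post)) hs
    have h3 := Reaches.jump (pre := pre ++ [.jumpLt a b (pre.length + 2 + c₂.size)] ++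
      c₂.code (pre.length + 1)) (post := c₁.code (pre.length + 2 + c₂.size) ++ post) h2.bounded
        (pre.length + 2 + c₂.size + c₁.size)
    rw [if_neg hlt] at hj
    refine ⟨s'.tick, h1, .trans (s₂ := s.tick) (l₂ := pre.length + 1) ?_
      (.trans (s₂ := s') (l₂ := pre.length + 1 + c₂.size) ?_ ?_)⟩
    · simpa [code] using hj
    · simpa [code, size, Nat.add_assoc] using h2
    · simpa [code, size, length_code, Nat.add_assoc, Nat.add_comm c₂.size 1] using h3

/-- One unrolling of the loop. The tick after the body is the jump back; leaving costs two ticks,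
the failed test and the jump past the body. Termination is left to the user, who must apply the rule
inductively. -/
theorem Cmd.WP.whileLt {W : ℕ} {a b : ℕ} {c : Cmd} {Q : State → Prop} {s : State}
    (h₁ : s.reg a < s.reg b → c.WP W (fun s' => (Cmd.whileLt a b c).WP W Q s'.tick) s.tick)
    (h₂ : ¬ s.reg a < s.reg b → Q s.tick.tick) : (Cmd.whileLt a b c).WP W Q s := by
  intro pre post hs
  have hj := Reaches.jumpLt (pre := pre) (post := [.jump (pre.length + 3 + c.size)] ++
    (c.code (pre.length + 2) ++ ([.jump pre.length] ++ post))) hs a b (pre.length + 2)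
  by_cases hlt : s.reg a < s.reg b
  · obtain ⟨s₁, h1, h2⟩ := h₁ hlt
      (pre ++ [.jumpLt a b (pre.length + 2), .jump (pre.length + 3 + c.size)])
      ([.jump pre.length] ++ post) hs
    have h3 := Reaches.jump (pre := pre ++
      [.jumpLt a b (pre.length + 2), .jump (pre.length + 3 + c.size)] ++
      c.code (pre.length + 2)) (post := post) h2.bounded pre.length
    obtain ⟨s₂, h4, h5⟩ := h1 pre post h3.bounded
    rw [if_pos hlt] at hj
    refine ⟨s₂, h4, .trans (s₂ := s.tick) (l₂ := pre.length + 2) ?_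
      (.trans (s₂ := s₁) (l₂ := pre.length + 2 + c.size) ?_
      (.trans (s₂ := s₁.tick) (l₂ := pre.length) ?_ h5))⟩
    · simpa [code] using hj
    · simpa [code, size, Nat.add_assoc] using h2
    · simpa [code, size, length_code, Nat.add_assoc, Nat.add_comm c.size 2] using h3
  · have h3 := Reaches.jump (pre := pre ++ [.jumpLt a b (pre.length + 2)])
      (post := c.code (pre.length + 2) ++ ([.jump pre.length] ++ post)) (s := s.tick) hs
      (pre.length + 3 + c.size)
    rw [if_neg hlt] at hj
    refine ⟨s.tick.tick, h₂ hlt, .trans (s₂ := s.tick) (l₂ := pre.length + 1) ?_ ?_⟩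
    · simpa [code] using hj
    · simpa [code, size, Nat.add_assoc] using h3

/-- A structured program that halts is a correct machine program. -/
theorem Cmd.WP.computes {W : ℕ} {c : Cmd} {input : List ℕ} {Q : State → Prop}
    (hin : ∀ x ∈ input, x ≤ W) (h : c.WP W Q ⟨fun _ => 0, fun a => input.getD a 0, 0⟩) :
    ∃ s, Q s ∧ Computes (c.code 0) input (s.reg 0) s.time W := by
  obtain ⟨s, hQ, t, ht, hr, hb⟩ := h [] [] ⟨fun _ => Nat.zero_le _, fun a => by
    change input.getD a 0 ≤ W
    rw [List.getD_eq_getElem?_getD]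
    rcases lt_or_ge a input.length with h1 | h1
    · simpa [h1] using hin _ (List.getElem_mem h1)
    · simp [h1]⟩
  simp only [List.length_nil, List.nil_append, List.append_nil, zero_add] at ht hr hb
  refine ⟨s, hQ, ?_⟩
  have hrun : run (c.code 0) input s.time = s.toConfig c.size := by
    rw [ht]; exact hr
  refine ⟨?_, by rw [hrun]; rfl, fun u hu => hb u (by omega)⟩
  rw [hrun, Halted, length_code]
  exact le_rfl

/-- The rule for counting loops, by induction on the number `N - i` of remaining rounds. The walk
through the linked list has no such counter and uses `Cmd.WP.whileLt` directly. -/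
theorem Cmd.WP.while_induction {W a b : ℕ} {c : Cmd} {Q : State → Prop} {s : State}
    (I : ℕ → State → Prop) (N : ℕ) {i : ℕ} (hi : i ≤ N) (hs : I i s)
    (hlt : ∀ i s, I i s → (s.reg a < s.reg b ↔ i < N))
    (hc : ∀ i s, i < N → I i s → c.WP W (fun s' => I (i + 1) s'.tick) s.tick)
    (hQ : ∀ s, I N s → Q s.tick.tick) : (Cmd.whileLt a b c).WP W Q s := by
  induction hd : N - i generalizing i s with
  | zero =>
    obtain rfl : i = N := by omega
    exact .whileLt (fun h => absurd ((hlt _ _ hs).1 h) (by omega)) (fun _ => hQ _ hs)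
  | succ d ih =>
    have hi' : i < N := by omega
    exact .whileLt (fun _ => (hc i s hi' hs).mono fun s' h' => ih hi' h' (by omega))
      (fun h => absurd ((hlt _ _ hs).2 hi') h)

/-! ### Linked lists, memory layout and adjacency in terms of positions -/

/-- In the array `f`, the node `a` is followed by the nodes of `L`, linked in this order and
terminated by `0`. -/
def Linked (f : ℕ → ℕ) : ℕ → List ℕ → Prop
  | a, [] => f a = 0
  | a, b :: L => f a = b ∧ Linked f b L

theorem Linked.congr {f g : ℕ → ℕ} {a a' : ℕ} {L : List ℕ} (h : Linked f a L) (ha : g a' = f a)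
    (hL : ∀ j ∈ L, g j = f j) : Linked g a' L := by
  induction L generalizing a a' with
  | nil => exact ha.trans h
  | cons b L ih =>
    exact ⟨ha.trans h.1, ih h.2 (hL b (by simp)) fun j hj => hL j (by simp [hj])⟩

theorem countP_le_card {L : List ℕ} (hL : L.Nodup) (p : ℕ → Bool) (S : Finset ℕ)
    (h : ∀ j ∈ L, p j = true → j ∈ S) : L.countP p ≤ S.card := by
  rw [List.countP_eq_length_filter, ← List.toFinset_card_of_nodup (hL.filter p)]
  refine Finset.card_le_card fun j hj => ?_
  rw [List.mem_toFinset, List.mem_filter] at hj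
  exact h j hj.1 hj.2

/-- The address where the list of the vertex with identifier `x` starts. -/
def listStart (n : ℕ) (M : ℕ → ℕ) (x : ℕ) : ℕ := 2 * n + 1 + ∑ y ∈ Finset.range x, M (n + 1 + y)

theorem listStart_succ (n : ℕ) (M : ℕ → ℕ) (x : ℕ) :
    listStart n M (x + 1) = listStart n M x + M (n + 1 + x) := by
  rw [listStart, listStart, Finset.sum_range_succ, ← Nat.add_assoc]

theorem listStart_mono (n : ℕ) (M : ℕ → ℕ) : Monotone (listStart n M) :=
  monotone_nat_of_le_succ fun x => by rw [listStart_succ]; omega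

/-- The memory `M` holds an input with `n` vertices; `pos x`, counted from `1`, is the position in
the labeling of the vertex with identifier `x`. -/
structure IsInput (n : ℕ) (M pos : ℕ → ℕ) : Prop where
  size : M 0 = n
  lab_lt : ∀ k, 1 ≤ k → k ≤ n → M k < n
  pos_lab : ∀ k, 1 ≤ k → k ≤ n → pos (M k) = k
  pos_pos : ∀ x < n, 1 ≤ pos x
  pos_le : ∀ x < n, pos x ≤ n
  lab_pos : ∀ x < n, M (pos x) = x
  entry_lt : ∀ a, 2 * n + 1 ≤ a → a < listStart n M n → M a < n
  eq_zero : ∀ a, listStart n M n ≤ a → M a = 0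

/-- The vertex at position `p` is in the adjacency list of the vertex at position `k`. -/
def PosAdj (n : ℕ) (M pos : ℕ → ℕ) (k p : ℕ) : Prop :=
  ∃ a, listStart n M (M k) ≤ a ∧ a < listStart n M (M k) + M (n + 1 + M k) ∧ pos (M a) = p

/-- The registers holding constants: the number `n` and the bases of the working arrays. -/
structure Frame (n B : ℕ) (r : ℕ → ℕ) : Prop where
  one : r 1 = 1
  size : r 2 = n
  start : r 3 = B
  pos : r 4 = B + (n + 1)
  mark : r 5 = B + 2 * (n + 1)
  max : r 6 = B + 3 * (n + 1)
  next : r 7 = B + 4 * (n + 1)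

theorem Frame.update {n B : ℕ} {r : ℕ → ℕ} (h : Frame n B r) {d : ℕ} (hd : d = 0 ∨ 8 ≤ d) (x : ℕ) :
    Frame n B (Function.update r d x) := by
  constructor <;> rw [Function.update_of_ne (by omega)]
  exacts [h.one, h.size, h.start, h.pos, h.mark, h.max, h.next]

/-! ### The amortized walk through earlier positions -/

/-- Walk through the linked list of earlier positions. -/
def walkCmd : Cmd :=
  .whileLt 11 13 (.seq (.block [.add 16 6 13, .load 16 16, .add 15 7 13])
    (.ifLt 8 16
      (.seq (.block [.add 17 5 13, .load 17 17])
        (.ifLt 17 8 (.block [.const 0 0, .const 13 0]) (.block [.move 14 15, .load 13 15])))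
      (.block [.load 13 15, .store 14 13])))

/-- Induction on the part of the list still ahead, with `prev` the last node kept. In the time
bound, a deletion is paid by the shortening of the list, passing a neighbour by the `countP` term,
and the end of the walk by the constant `40`. The clause on untouched links is there for the
induction: it protects the link into a node that is kept. -/
theorem walkCmd_spec {n B W k : ℕ} (hW : B + 5 * (n + 1) ≤ W) {L : List ℕ} {prev : ℕ} {s : State}
    (hF : Frame n B s.reg) (hk : s.reg 8 = k) (hcur : s.reg 13 = s.mem (B + 4 * (n + 1) + prev))
    (hprev : s.reg 14 = B + 4 * (n + 1) + prev) (hpn : prev ≤ n) (hpL : prev ∉ L)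
    (hL : Linked (fun j => s.mem (B + 4 * (n + 1) + j)) prev L)
    (hdec : L.Pairwise (· > ·)) (hLn : ∀ j ∈ L, j ≤ n)
    (hmark : ∀ j ≤ n, s.mem (B + 2 * (n + 1) + j) ≤ k) :
    walkCmd.WP W (fun s' => ∃ L', L'.Sublist L ∧ Frame n B s'.reg ∧ s'.reg 8 = k ∧
      Linked (fun j => s'.mem (B + 4 * (n + 1) + j)) prev L' ∧
      (∀ j ∈ L, k < s.mem (B + 3 * (n + 1) + j) → j ∈ L') ∧
      (∀ a < B + 4 * (n + 1), s'.mem a = s.mem a) ∧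
      (∀ j, j ≠ prev → j ∉ L → s'.mem (B + 4 * (n + 1) + j) = s.mem (B + 4 * (n + 1) + j)) ∧
      (s'.reg 0 = if ∃ j ∈ L, s.reg 11 < j ∧ k < s.mem (B + 3 * (n + 1) + j) ∧
        s.mem (B + 2 * (n + 1) + j) < k then 0 else s.reg 0) ∧
      s'.time + 20 * L'.length ≤ s.time + 20 * L.length + 40 +
        20 * L.countP (fun j => s.mem (B + 2 * (n + 1) + j) = k)) s := by
  classical
  induction L generalizing prev s with
  | nil =>
    have h0 : s.reg 13 = 0 := hcur.trans hL
    refine .whileLt (fun h => by omega) fun _ => ?_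
    refine ⟨[], by simp, hF, hk, hL, by simp, fun _ _ => rfl, fun _ _ _ => rfl, by simp [State.tick],
      by simp [State.tick]⟩
  | cons b L ih =>
    have hb : s.reg 13 = b := hcur.trans hL.1
    have hbn : b ≤ n := hLn b (by simp)
    rw [List.pairwise_cons] at hdec
    have hbL : b ∉ L := fun h => lt_irrefl _ (hdec.1 b h)
    have hLn' : ∀ j ∈ L, j ≤ n := fun j hj => hLn j (by simp [hj])
    have hpL' : prev ∉ L := fun h => hpL (by simp [h])
    have hpb : prev ≠ b := fun h => hpL (by simp [h])
    refine .whileLt (fun hlt => ?_) fun hlt => ?_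
    · refine .seq (.block ?_)
      simp only [opsWP, Op.Safe, Op.eval, State.tick, Function.update_apply, Nat.reduceEqDiff,
        ↓reduceIte, hF.max, hF.next, hb, true_and]
      refine ⟨by omega, by omega, .ifLt (fun h1 => ?_) (fun h1 => ?_)⟩
      · refine .seq (.block ?_)
        simp only [opsWP, Op.Safe, Op.eval, State.tick, Function.update_apply, Nat.reduceEqDiff,
          ↓reduceIte, hF.mark, hb, hk, true_and] at h1 ⊢
        refine ⟨by omega, .ifLt (fun h2 => .block ?_) (fun h2 => .block ?_)⟩
        · simp only [opsWP, Op.Safe, Op.eval, State.tick, Function.update_apply, Nat.reduceEqDiff,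
            ↓reduceIte, hk] at h2 ⊢
          -- A jump has been found. The cursor is now the null node `0`, so the loop test fails.
          refine ⟨by omega, by omega, .whileLt (fun h => ?_) fun _ => ?_⟩
          · simp at h
          · refine ⟨b :: L, List.Sublist.refl _, ?_, ?_, hL, fun j hj _ => hj, fun _ _ => rfl,
              fun _ _ _ => rfl, ?_, ?_⟩
            · repeat refine Frame.update ?_ (by decide) _
              exact hF
            · simp [State.tick, hk]
            · rw [if_pos ⟨b, by simp, by omega, h1, h2⟩]
              simp [State.tick]
            · simp only [State.tick]
              omega
        · simp only [opsWP, Op.Safe, Op.eval, State.tick, Function.update_apply, Nat.reduceEqDiff,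
            ↓reduceIte, hk, true_and] at h2 ⊢
          -- No stamp exceeds `k`, so one that is not smaller is `k` itself: `b` is a neighbour and
          -- its visit is paid by `countP`.
          have hbk : s.mem (B + 2 * (n + 1) + b) = k := le_antisymm (hmark b hbn) (not_lt.1 h2)
          refine (ih (prev := b) ?_ ?_ ?_ ?_ hbn hbL ?_ hdec.2 hLn' ?_).mono ?_
          · repeat refine Frame.update ?_ (by decide) _
            exact hF
          · simp [hk]
          · simp
          · simp
          · exact hL.2
          · exact hmark
          · rintro s' ⟨L', h1', h2', h3, h4, h5, h6, h7, h8, h9⟩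
            refine ⟨b :: L', h1'.cons_cons b, h2', h3, ⟨?_, h4⟩, ?_, h6, ?_, ?_, ?_⟩
            · exact (h7 prev hpb hpL').trans hL.1
            · intro j hj hj'
              rcases List.mem_cons.1 hj with rfl | hj
              · simp
              · exact List.mem_cons_of_mem _ (h5 j hj hj')
            · intro j _ hj
              rw [List.mem_cons, not_or] at hj
              exact h7 j hj.1 hj.2
            · rw [h8]
              have : ¬ s.mem (B + 2 * (n + 1) + b) < k := h2
              simp [this]
            · rw [List.countP_cons_of_pos (by simpa using hbk)]
              simp only [List.length_cons] at h9 ⊢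
              omega
      · simp only [Function.update_apply, Nat.reduceEqDiff, ↓reduceIte, hk] at h1
        refine .block ?_
        simp only [opsWP, Op.Safe, Op.eval, State.tick, Function.update_apply, Nat.reduceEqDiff,
          ↓reduceIte, hprev, true_and]
        have hmem : ∀ a, a ≠ B + 4 * (n + 1) + prev → Function.update s.mem (B + 4 * (n + 1) + prev)
            (s.mem (B + 4 * (n + 1) + b)) a = s.mem a := fun a h => Function.update_of_ne h ..
        have hmx : ∀ j ∈ L, Function.update s.mem (B + 4 * (n + 1) + prev)
            (s.mem (B + 4 * (n + 1) + b)) (B + 3 * (n + 1) + j) = s.mem (B + 3 * (n + 1) + j) :=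
          fun j hj => hmem _ (by have := hLn' j hj; omega)
        have hmk : ∀ j ≤ n, Function.update s.mem (B + 4 * (n + 1) + prev)
            (s.mem (B + 4 * (n + 1) + b)) (B + 2 * (n + 1) + j) = s.mem (B + 2 * (n + 1) + j) :=
          fun j hj => hmem _ (by omega)
        refine (ih (prev := prev) ?_ ?_ ?_ ?_ hpn hpL' ?_ hdec.2 hLn' ?_).mono ?_
        · repeat refine Frame.update ?_ (by decide) _
          exact hF
        · simp [hk]
        · simp
        · simp [hprev]
        -- Unlinking `b` lets `prev` inherit the successor of `b`; later links are intact since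
        -- `prev ∉ L`.
        · refine hL.2.congr (by simp) fun j hj => hmem _ ?_
          have : j ≠ prev := fun h => hpL' (h ▸ hj)
          omega
        · intro j hj
          exact (hmk j hj).trans_le (hmark j hj)
        · rintro s' ⟨L', h1', h2', h3, h4, h5, h6, h7, h8, h9⟩
          refine ⟨L', h1'.cons b, h2', h3, h4, ?_, ?_, ?_, ?_, ?_⟩
          · intro j hj hj'
            rcases List.mem_cons.1 hj with rfl | hj
            · exact absurd hj' h1
            · exact h5 j hj (hj'.trans_eq (hmx j hj).symm)
          · exact fun a ha => (h6 a ha).trans (hmem _ (by omega))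
          · intro j hj hj'
            rw [List.mem_cons, not_or] at hj'
            exact (h7 j hj hj'.2).trans (hmem _ (by omega))
          · rw [h8]
            congr 1
            rw [List.exists_mem_cons_iff]
            simp only [h1, false_and, and_false, false_or, eq_iff_iff]
            refine exists_congr fun j => and_congr_right fun hj => ?_
            rw [hmx j hj, hmk j (hLn' j hj)]
            simp
          · have hc : L.countP (fun j => decide (Function.update s.mem (B + 4 * (n + 1) + prev)
                (s.mem (B + 4 * (n + 1) + b)) (B + 2 * (n + 1) + j) = k)) =
                L.countP (fun j => s.mem (B + 2 * (n + 1) + j) = k) :=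
              List.countP_congr fun j hj => by rw [hmk j (hLn' j hj)]
            rw [hc] at h9
            rw [List.countP_cons]
            simp only [List.length_cons] at h9 ⊢
            omega
    · refine ⟨b :: L, List.Sublist.refl _, hF, hk, hL, fun j hj _ => hj, fun _ _ => rfl,
        fun _ _ _ => rfl, ?_, ?_⟩
      -- The walk stops at the first node not above the threshold; by the decreasing order no later
      -- node is above it either.
      · rw [if_neg]
        · rfl
        · rintro ⟨j, hj, h1, -⟩
          rcases List.mem_cons.1 hj with rfl | hj
          · omega
          · have := hdec.1 j hj
            omega
      · simp only [State.tick]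
        omega

/-! ### Preprocessing: sizes, list starts and positions -/

/-- The memory below the working arrays: the input, the table of the starts of the adjacency lists
and the table of positions. -/
structure Tables (n : ℕ) (M pos mem : ℕ → ℕ) : Prop where
  input : ∀ a < listStart n M n, mem a = M a
  start : ∀ x < n, mem (listStart n M n + x) = listStart n M x
  pos : ∀ x < n, mem (listStart n M n + (n + 1) + x) = pos x

theorem Tables.congr {n : ℕ} {M pos mem mem' : ℕ → ℕ} (h : Tables n M pos mem)
    (h' : ∀ a < listStart n M n + 2 * (n + 1), mem' a = mem a) : Tables n M pos mem' :=
  ⟨fun a ha => (h' a (by omega)).trans (h.input a ha),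
    fun x hx => (h' _ (by omega)).trans (h.start x hx),
    fun x hx => (h' _ (by omega)).trans (h.pos x hx)⟩

/-- Compute the end of the input. -/
def sizeCmd : Cmd :=
  .seq (.block [.const 0 1, .const 1 1, .const 9 0, .load 2 9, .add 3 2 2, .add 3 3 1, .add 9 2 1,
      .const 8 0])
    (.whileLt 8 2 (.block [.load 15 9, .add 3 3 15, .add 9 9 1, .add 8 8 1]))

theorem sizeCmd_spec {n W : ℕ} {M pos : ℕ → ℕ} (hM : IsInput n M pos)
    (hW : listStart n M n + 5 * (n + 1) ≤ W) :
    sizeCmd.WP W (fun s => s.reg 0 = 1 ∧ s.reg 1 = 1 ∧ s.reg 2 = n ∧ s.reg 3 = listStart n M n ∧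
      s.mem = M ∧ s.time ≤ 10 * (n + 1)) ⟨fun _ => 0, M, 0⟩ := by
  refine .seq (.block ?_)
  simp only [opsWP, Op.Safe, Op.eval, Function.update_apply, Nat.reduceEqDiff, ↓reduceIte, hM.size,
    true_and]
  refine ⟨by omega, by omega, by omega, by omega, by omega, by omega, by omega, ?_⟩
  refine .while_induction (fun i s => s.reg 0 = 1 ∧ s.reg 1 = 1 ∧ s.reg 2 = n ∧
    s.reg 3 = listStart n M i ∧ s.mem = M ∧ s.reg 8 = i ∧ s.reg 9 = n + 1 + i ∧
    s.time ≤ 8 + 10 * i) n (Nat.zero_le n) ?_ ?_ ?_ ?_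
  · simp [listStart]
    omega
  · rintro i s ⟨-, -, h2, -, -, h8, -⟩
    rw [h2, h8]
  · rintro i s hi ⟨h0, h1, h2, h3, hm, h8, h9, ht⟩
    have hs := listStart_succ n M i
    have hl := listStart_mono n M (show i + 1 ≤ n from hi)
    refine .block ?_
    simp only [opsWP, Op.Safe, Op.eval, State.tick, Function.update_apply, Nat.reduceEqDiff,
      ↓reduceIte, h0, h1, h2, h3, hm, h8, h9, true_and]
    refine ⟨by omega, by omega, by omega, hs.symm, by omega, by omega⟩
  · rintro s ⟨h0, h1, h2, h3, hm, -, -, ht⟩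
    exact ⟨h0, h1, h2, h3, hm, by simp only [State.tick]; omega⟩

/-- Lay out the working arrays, and fill the tables of starts and of positions. -/
def tableCmd : Cmd :=
  .seq (.block [.add 19 2 1, .add 4 3 19, .add 5 4 19, .add 6 5 19, .add 7 6 19, .const 8 0,
      .move 9 19, .add 10 2 19])
    (.whileLt 8 2 (.block [.add 18 8 1, .load 15 18, .add 16 4 15, .store 16 18, .add 17 3 8,
      .store 17 10, .load 16 9, .add 10 10 16, .add 9 9 1, .move 8 18]))

theorem tableCmd_spec {n W : ℕ} {M pos : ℕ → ℕ} (hM : IsInput n M pos)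
    (hW : listStart n M n + 5 * (n + 1) ≤ W) {s : State} (h0 : s.reg 0 = 1) (h1 : s.reg 1 = 1)
    (h2 : s.reg 2 = n) (h3 : s.reg 3 = listStart n M n) (hm : s.mem = M)
    (ht : s.time ≤ 10 * (n + 1)) :
    tableCmd.WP W (fun s => s.reg 0 = 1 ∧ Frame n (listStart n M n) s.reg ∧ Tables n M pos s.mem ∧
      (∀ a, listStart n M n + 2 * (n + 1) ≤ a → s.mem a = 0) ∧ s.time ≤ 30 * (n + 1)) s := by
  have hB := listStart_mono n M (Nat.zero_le n)
  have hB0 : listStart n M 0 = 2 * n + 1 := by simp [listStart]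
  rw [hB0] at hB
  refine .seq (.block ?_)
  simp only [opsWP, Op.Safe, Op.eval, Function.update_apply, Nat.reduceEqDiff, ↓reduceIte,
    h1, h2, h3, true_and]
  refine ⟨by omega, by omega, by omega, by omega, by omega, by omega, by omega, ?_⟩
  refine .while_induction (fun i s => s.reg 0 = 1 ∧ Frame n (listStart n M n) s.reg ∧
    s.reg 8 = i ∧ s.reg 9 = n + 1 + i ∧ s.reg 10 = listStart n M i ∧
    (∀ a < listStart n M n, s.mem a = M a) ∧
    (∀ x < i, s.mem (listStart n M n + x) = listStart n M x) ∧
    (∀ j, 1 ≤ j → j ≤ i → s.mem (listStart n M n + (n + 1) + M j) = j) ∧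
    (∀ a, listStart n M n + 2 * (n + 1) ≤ a → s.mem a = 0) ∧
    s.time ≤ 10 * (n + 1) + 8 + 15 * i) n (Nat.zero_le n) ?_ ?_ ?_ ?_
  · refine ⟨by simpa using h0, ?_, by simp, by simp, by simp [hB0]; omega, by simp [hm], by simp,
      fun j h1 h2 => by omega, fun a ha => ?_, ?_⟩
    · constructor <;> simp [h1, h2, h3] <;> omega
    · simp only [hm]
      exact hM.eq_zero a (by omega)
    · simp only
      omega
  · rintro i s ⟨-, hF, h8, -⟩
    rw [hF.size, h8]
  · rintro i s hi ⟨h0, hF, h8, h9, h10, hin, hst, hpo, hz, ht⟩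
    have hs := listStart_succ n M i
    have hl := listStart_mono n M (show i + 1 ≤ n from hi)
    have hlab := hM.lab_lt (i + 1) (by omega) hi
    have hlab' : s.mem (i + 1) = M (i + 1) := hin _ (by omega)
    have hlen : s.mem (n + 1 + i) = M (n + 1 + i) := hin _ (by omega)
    refine .block ?_
    have e1 : n + 1 + i ≠ listStart n M n + (n + 1) + M (i + 1) := by omega
    have e2 : n + 1 + i ≠ listStart n M n + i := by omega
    simp only [opsWP, Op.Safe, Op.eval, State.tick, Function.update_apply, Nat.reduceEqDiff,
      ↓reduceIte, h0, hF.one, hF.start, hF.pos, h8, h9, h10, true_and, hlab', hlen, e1, e2]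
    refine ⟨by omega, by omega, by omega, by omega, by omega, ?_, by omega, hs.symm, ?_, ?_, ?_, ?_,
      by omega⟩
    · repeat refine Frame.update ?_ (by decide) _
      exact hF
    · intro a ha
      rw [if_neg (by omega), if_neg (by omega), hin a ha]
    · intro x hx
      rcases Nat.lt_succ_iff_lt_or_eq.1 hx with hx | rfl
      · rw [if_neg (by omega), if_neg (by omega), hst x hx]
      · rw [if_pos rfl]
    · intro j hj hj'
      rw [if_neg (by omega)]
      rcases Nat.le_succ_iff.1 hj' with hj' | rfl
      -- Writing the new position does not overwrite an old one: equal labels would have equal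
      -- positions.
      · rw [if_neg, hpo j hj hj']
        intro h
        have h' : M j = M (i + 1) := by omega
        have := hM.pos_lab j hj (by omega)
        rw [h', hM.pos_lab _ (by omega) hi] at this
        omega
      · rw [if_pos rfl]
    · intro a ha
      rw [if_neg (by omega), if_neg (by omega), hz a ha]
  · rintro s ⟨h0, hF, h8, h9, h10, hin, hst, hpo, hz, ht⟩
    refine ⟨h0, hF, ⟨hin, hst, fun x hx => ?_⟩, hz, by simp only [State.tick]; omega⟩
    -- The table was filled by position; every identifier is reached because `x` is the label at
    -- `pos x`.
    have := hpo (pos x) (hM.pos_pos x hx) (hM.pos_le x hx)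
    rwa [hM.lab_pos x hx] at this

/-- Both branches take two steps (test and move, or test and jump), so the minimum and maximum
updates need no case split. -/
theorem Cmd.WP.conditional_move {W a b d c : ℕ} {Q : State → Prop} {s : State}
    (h : Q ⟨Function.update s.reg d (if s.reg a < s.reg b then s.reg c else s.reg d), s.mem,
      s.time + 2⟩) : (Cmd.ifLt a b (.block [.move d c]) (.block [])).WP W Q s := by
  refine .ifLt (fun hlt => .block ⟨trivial, ?_⟩) (fun hlt => .block ?_)
  · rw [if_pos hlt] at h
    exact h
  · rw [if_neg hlt, Function.update_eq_self] at h
    exact h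

/-! ### Scanning one adjacency list -/

/-- Scan the adjacency list of the current vertex: mark the neighbours, and find the smallest and
the largest position. -/
def scanCmd : Cmd :=
  .whileLt 9 10 (.seq (.block [.load 15 9, .add 15 4 15, .load 18 15, .add 16 5 18, .store 16 8])
    (.seq (.ifLt 18 11 (.block [.move 11 18]) (.block []))
      (.seq (.ifLt 12 18 (.block [.move 12 18]) (.block [])) (.block [.add 9 9 1]))))

/-- Both extremes start at `k`, which also covers an empty list. They are therefore described only
by comparisons, with `j ≤ k` for the minimum and `j ≥ k` for the maximum, where the starting value
cannot interfere. As all old stamps are below `k`, the stamp `k` identifies exactly the neighbours.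
-/
theorem scanCmd_spec {n W k a e : ℕ} {M pos : ℕ → ℕ} (hM : IsInput n M pos)
    (hW : listStart n M n + 5 * (n + 1) ≤ W) {s : State} (hF : Frame n (listStart n M n) s.reg)
    (hT : Tables n M pos s.mem) (hae : a ≤ e) (ha : 2 * n + 1 ≤ a) (he : e ≤ listStart n M n)
    (h8 : s.reg 8 = k) (h9 : s.reg 9 = a) (h10 : s.reg 10 = e) (h11 : s.reg 11 = k)
    (h12 : s.reg 12 = k)
    (hmark : ∀ j ≤ n, s.mem (listStart n M n + 2 * (n + 1) + j) < k) :
    scanCmd.WP W (fun s' => Frame n (listStart n M n) s'.reg ∧ s'.reg 8 = k ∧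
      s'.reg 0 = s.reg 0 ∧
      (∀ j ≤ k, s'.reg 11 < j ↔ ∃ b, a ≤ b ∧ b < e ∧ pos (M b) < j) ∧
      (∀ j ≥ k, j < s'.reg 12 ↔ ∃ b, a ≤ b ∧ b < e ∧ j < pos (M b)) ∧
      (∀ j ≤ n, s'.mem (listStart n M n + 2 * (n + 1) + j) ≤ k) ∧
      (∀ j ≤ n, s'.mem (listStart n M n + 2 * (n + 1) + j) = k ↔
        ∃ b, a ≤ b ∧ b < e ∧ pos (M b) = j) ∧
      (∀ c, c < listStart n M n + 2 * (n + 1) ∨ listStart n M n + 3 * (n + 1) ≤ c →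
        s'.mem c = s.mem c) ∧
      s'.time ≤ s.time + 20 * (e - a) + 2) s := by
  refine .while_induction (fun a' s' => Frame n (listStart n M n) s'.reg ∧ s'.reg 8 = k ∧
      s'.reg 0 = s.reg 0 ∧ s'.reg 9 = a' ∧ s'.reg 10 = e ∧ a ≤ a' ∧
      (∀ j ≤ k, s'.reg 11 < j ↔ ∃ b, a ≤ b ∧ b < a' ∧ pos (M b) < j) ∧
      (∀ j ≥ k, j < s'.reg 12 ↔ ∃ b, a ≤ b ∧ b < a' ∧ j < pos (M b)) ∧
      (∀ j ≤ n, s'.mem (listStart n M n + 2 * (n + 1) + j) ≤ k) ∧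
      (∀ j ≤ n, s'.mem (listStart n M n + 2 * (n + 1) + j) = k ↔
        ∃ b, a ≤ b ∧ b < a' ∧ pos (M b) = j) ∧
      (∀ c, c < listStart n M n + 2 * (n + 1) ∨ listStart n M n + 3 * (n + 1) ≤ c →
        s'.mem c = s.mem c) ∧
      s'.time ≤ s.time + 20 * (a' - a)) e hae ?_ ?_ ?_ ?_
  · refine ⟨hF, h8, rfl, h9, h10, le_rfl, ?_, ?_, fun j hj => (hmark j hj).le, ?_, fun _ _ => rfl,
      by omega⟩
    · exact fun j hj => ⟨fun h => by omega, fun ⟨b, h, h', _⟩ => by omega⟩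
    · exact fun j hj => ⟨fun h => by omega, fun ⟨b, h, h', _⟩ => by omega⟩
    · exact fun j hj => ⟨fun h => absurd h (hmark j hj).ne, fun ⟨b, h, h', _⟩ => by omega⟩
  · rintro i s' ⟨-, -, -, h9, h10, -⟩
    rw [h9, h10]
  · rintro i s' hi ⟨hF, h8, h0, h9, h10, hai, h11, h12, hmk, hadj, hmem, ht⟩
    have hT' : Tables n M pos s'.mem := hT.congr fun c hc => hmem c (.inl hc)
    have hx := hM.entry_lt i (by omega) (by omega)
    have hp := hM.pos_le _ hx
    have l1 : s'.mem i = M i := hT'.input i (by omega)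
    have l2 := hT'.pos _ hx
    have key : ∀ P : ℕ → Prop, (∃ b, a ≤ b ∧ b < i + 1 ∧ P b) ↔ (∃ b, a ≤ b ∧ b < i ∧ P b) ∨ P i := by
      intro P
      constructor
      · rintro ⟨b, hb, hb', h⟩
        rcases Nat.lt_succ_iff_lt_or_eq.1 hb' with hb' | rfl
        exacts [.inl ⟨b, hb, hb', h⟩, .inr h]
      · rintro (⟨b, hb, hb', h⟩ | h)
        exacts [⟨b, hb, by omega, h⟩, ⟨i, hai, by omega, h⟩]
    simp only [key]
    refine .seq (.block ?_)
    simp only [opsWP, Op.Safe, Op.eval, State.tick, Function.update_apply, Nat.reduceEqDiff,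
      ↓reduceIte, hF.mark, hF.pos, h8, h9, true_and, l1, l2]
    refine ⟨by omega, by omega, .seq (.conditional_move (.seq (.conditional_move (.block ?_))))⟩
    simp only [opsWP, Op.Safe, Op.eval, Function.update_apply, Nat.reduceEqDiff,
      ↓reduceIte, hF.one, h8, h9, h10, h0, true_and]
    refine ⟨by omega, ?_, by omega, ?_, ?_, ?_, ?_, ?_, by omega⟩
    · repeat refine Frame.update ?_ (by decide) _
      exact hF
    · intro j hj
      rw [← h11 j hj]
      split_ifs <;> omega
    · intro j hj
      rw [← h12 j hj]
      split_ifs <;> omega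
    · intro j hj
      split_ifs
      exacts [le_rfl, hmk j hj]
    · intro j hj
      rw [← hadj j hj]
      split_ifs with h
      · simp only [true_iff]
        omega
      · simp only [iff_self_or]
        omega
    · intro c hc
      rw [if_neg (by omega), hmem c hc]
  · rintro s' ⟨hF, h8, h0, h9, h10, hai, h11, h12, hmk, hadj, hmem, ht⟩
    exact ⟨hF, h8, h0, h11, h12, hmk, hadj, hmem, by simp only [State.tick]; omega⟩

/-! ### The invariant and the treatment of one position -/

/-- Position `k` is the third position of a jump. -/
def JumpAt (n : ℕ) (M pos : ℕ → ℕ) (k : ℕ) : Prop :=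
  ∃ i j l, i < j ∧ j < k ∧ k < l ∧ PosAdj n M pos k i ∧ PosAdj n M pos j l ∧ ¬ PosAdj n M pos k j

open Classical in
/-- The state of the machine after the first `k` positions have been treated. -/
structure Invariant (n : ℕ) (M pos : ℕ → ℕ) (k : ℕ) (s : State) : Prop where
  frame : Frame n (listStart n M n) s.reg
  counter : s.reg 8 = k
  tables : Tables n M pos s.mem
  mark : ∀ j ≤ n, s.mem (listStart n M n + 2 * (n + 1) + j) ≤ k
  max : ∀ j, 1 ≤ j → j ≤ k → ∀ k' ≥ j,
    (k' < s.mem (listStart n M n + 3 * (n + 1) + j) ↔ ∃ l, k' < l ∧ PosAdj n M pos j l)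
  out : s.reg 0 = if ∃ k' ≤ k, 1 ≤ k' ∧ JumpAt n M pos k' then 0 else 1
  list : ∃ L, Linked (fun j => s.mem (listStart n M n + 4 * (n + 1) + j)) 0 L ∧
    L.Pairwise (· > ·) ∧ (∀ j ∈ L, 1 ≤ j ∧ j ≤ k) ∧
    (∀ j, 1 ≤ j → j ≤ k → k < s.mem (listStart n M n + 3 * (n + 1) + j) → j ∈ L) ∧
    s.time + 20 * L.length ≤
      31 * (n + 1) + 150 * k + 40 * ∑ i ∈ Finset.range k, M (n + 1 + M (i + 1))

/-- Treat the next position. -/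
def visitCmd : Cmd :=
  .seq (.block [.add 8 8 1, .load 15 8, .add 9 3 15, .load 9 9, .add 10 2 1, .add 10 10 15,
      .load 10 10, .add 10 9 10, .move 11 8, .move 12 8])
    (.seq scanCmd (.seq (.block [.add 16 6 8, .store 16 12, .move 14 7, .load 13 14])
      (.seq walkCmd (.block [.load 16 7, .add 17 7 8, .store 17 16, .store 7 8]))))

/-- The machine's test agrees with `JumpAt` (`hjump`) because every earlier position with a
neighbour beyond `k` is still in the list. The cost agrees with the potential because at most as
many list nodes are stamped as the adjacency list has entries (`hcount`). -/
theorem visitCmd_spec {n W k : ℕ} {M pos : ℕ → ℕ} (hM : IsInput n M pos)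
    (hW : listStart n M n + 5 * (n + 1) ≤ W) (hk : k < n) {s : State}
    (hs : Invariant n M pos k s) :
    visitCmd.WP W (fun s' => Invariant n M pos (k + 1) s'.tick) s.tick := by
  classical
  obtain ⟨hF, h8, hT, hmark, hmax, hout, L, hL, hdec, hLk, hmem, ht⟩ := hs
  have hB := listStart_mono n M (Nat.zero_le (M (k + 1)))
  have hB0 : listStart n M 0 = 2 * n + 1 := by simp [listStart]
  rw [hB0] at hB
  have hv := hM.lab_lt (k + 1) (by omega) hk
  have hsucc := listStart_succ n M (M (k + 1))
  have hmono := listStart_mono n M (show M (k + 1) + 1 ≤ n from hv)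
  have l1 : s.mem (k + 1) = M (k + 1) := hT.input _ (by omega)
  have l2 := hT.start _ hv
  have l3 : s.mem (n + 1 + M (k + 1)) = M (n + 1 + M (k + 1)) := hT.input _ (by omega)
  refine .seq (.block ?_)
  simp only [opsWP, Op.Safe, Op.eval, State.tick, Function.update_apply, Nat.reduceEqDiff,
    ↓reduceIte, hF.one, hF.start, hF.size, h8, l1, l2, l3, true_and]
  refine ⟨by omega, by omega, by omega, by omega, by omega, .seq ?_⟩
  refine (scanCmd_spec (k := k + 1) (a := listStart n M (M (k + 1)))
    (e := listStart n M (M (k + 1) + 1)) hM hW ?_ (by exact hT) (by omega) hB hmono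
    ?_ ?_ ?_ ?_ ?_ ?_).mono ?_
  · repeat refine Frame.update ?_ (by decide) _
    exact hF
  · simp
  · simp
  · simp [hsucc]
  · simp
  · simp
  · exact fun j hj => Nat.lt_succ_of_le (hmark j hj)
  simp only [Function.update_apply, Nat.reduceEqDiff, ↓reduceIte]
  rintro s₁ ⟨hF₁, h8₁, h0₁, h11₁, h12₁, hle₁, hmark₁, hmem₁, ht₁⟩
  have hadj : ∀ j ≤ n, s₁.mem (listStart n M n + 2 * (n + 1) + j) = k + 1 ↔
      PosAdj n M pos (k + 1) j := by
    intro j hj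
    rw [hmark₁ j hj, PosAdj, hsucc]
  have hmin : ∀ j ≤ k + 1, s₁.reg 11 < j ↔ ∃ i, i < j ∧ PosAdj n M pos (k + 1) i := by
    intro j hj
    rw [h11₁ j hj, hsucc]
    exact ⟨fun ⟨b, h1, h2, h3⟩ => ⟨_, h3, b, h1, h2, rfl⟩,
      fun ⟨i, h3, b, h1, h2, h4⟩ => ⟨b, h1, h2, h4 ▸ h3⟩⟩
  have hmx : ∀ j ≥ k + 1, j < s₁.reg 12 ↔ ∃ l, j < l ∧ PosAdj n M pos (k + 1) l := by
    intro j hj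
    rw [h12₁ j hj, hsucc]
    exact ⟨fun ⟨b, h1, h2, h3⟩ => ⟨_, h3, b, h1, h2, rfl⟩,
      fun ⟨i, h3, b, h1, h2, h4⟩ => ⟨b, h1, h2, h4 ▸ h3⟩⟩
  clear h11₁ h12₁ hmark₁
  refine .seq (.block ?_)
  simp only [opsWP, Op.Safe, Op.eval, Function.update_apply, Nat.reduceEqDiff,
    ↓reduceIte, hF₁.max, hF₁.next, h8₁, true_and]
  rw [if_neg (by omega)]
  refine ⟨by omega, .seq ?_⟩
  -- `m` is the memory with the new maximum stored; below it is used only through `hm₁` and `hm₂`.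
  obtain ⟨m, hm⟩ : ∃ m, m = Function.update s₁.mem (listStart n M n + 3 * (n + 1) + (k + 1))
    (s₁.reg 12) := ⟨_, rfl⟩
  rw [← hm]
  have hm₁ : m (listStart n M n + 3 * (n + 1) + (k + 1)) = s₁.reg 12 := by
    rw [hm, Function.update_self]
  have hm₂ : ∀ c, c ≠ listStart n M n + 3 * (n + 1) + (k + 1) → m c = s₁.mem c := by
    intro c hc
    rw [hm, Function.update_of_ne hc]
  clear hm
  have hLn : ∀ j ∈ L, j ≤ n := fun j hj => (hLk j hj).2.trans hk.le
  have h0L : 0 ∉ L := fun h => by have := (hLk 0 h).1; omega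
  have hmark₂ : ∀ j ≤ n, m (listStart n M n + 2 * (n + 1) + j) =
      s₁.mem (listStart n M n + 2 * (n + 1) + j) := fun j hj => hm₂ _ (by omega)
  have hmax₂ : ∀ j, 1 ≤ j → j ≤ k + 1 → ∀ k' ≥ j,
      (k' < m (listStart n M n + 3 * (n + 1) + j) ↔ ∃ l, k' < l ∧ PosAdj n M pos j l) := by
    intro j hj hj' k' hk'
    rcases Nat.le_succ_iff.1 hj' with hj' | rfl
    · rw [hm₂ _ (by omega), hmem₁ _ (by omega), hmax j hj hj' k' hk']
    · rw [hm₁, hmx k' hk']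
  have hjump : (∃ j ∈ L, s₁.reg 11 < j ∧ k + 1 < m (listStart n M n + 3 * (n + 1) + j) ∧
      m (listStart n M n + 2 * (n + 1) + j) < k + 1) ↔ JumpAt n M pos (k + 1) := by
    constructor
    · rintro ⟨j, hj, h1, h2, h3⟩
      have hj1 := hLk j hj
      rw [hmin j (by omega)] at h1
      rw [hmax₂ j hj1.1 (by omega) _ (by omega)] at h2
      rw [hmark₂ j (hLn j hj)] at h3
      obtain ⟨i, hi, hi'⟩ := h1
      obtain ⟨l, hl, hl'⟩ := h2
      exact ⟨i, j, l, hi, by omega, hl, hi', hl', fun h => h3.ne ((hadj j (hLn j hj)).2 h)⟩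
    · rintro ⟨i, j, l, hi, hj, hl, hi', hl', h⟩
      have h1 : k + 1 < m (listStart n M n + 3 * (n + 1) + j) :=
        (hmax₂ j (by omega) (by omega) _ (by omega)).2 ⟨l, hl, hl'⟩
      -- The neighbour `l > k + 1` of `j` guarantees that `j` has not been deleted.
      refine ⟨j, hmem j (by omega) (by omega) ?_, (hmin j (by omega)).2 ⟨i, hi, hi'⟩, h1, ?_⟩
      · rw [← hmem₁ _ (by omega), ← hm₂ _ (by omega)]
        omega
      · rw [hmark₂ j (by omega)]
        exact lt_of_le_of_ne (hle₁ j (by omega)) fun h' => h ((hadj j (by omega)).1 h')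
  have hcount : L.countP (fun j => m (listStart n M n + 2 * (n + 1) + j) = k + 1) ≤
      M (n + 1 + M (k + 1)) := by
    refine (countP_le_card (hdec.imp fun h => ne_of_gt h) _ ((Finset.Ico (listStart n M (M (k + 1)))
      (listStart n M (M (k + 1) + 1))).image fun b => pos (M b)) fun j hj hj' => ?_).trans
        (Finset.card_image_le.trans (by rw [Nat.card_Ico]; omega))
    rw [decide_eq_true_iff, hmark₂ j (hLn j hj), hadj j (hLn j hj)] at hj'
    obtain ⟨b, h1, h2, h3⟩ := hj'
    exact Finset.mem_image.2 ⟨b, Finset.mem_Ico.2 ⟨h1, by omega⟩, h3⟩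
  refine (walkCmd_spec (k := k + 1) (prev := 0) hW (L := L) ?_ ?_ ?_ ?_ (Nat.zero_le n) h0L ?_ hdec
    hLn ?_).mono ?_
  · repeat refine Frame.update ?_ (by decide) _
    exact hF₁
  · simp [h8₁]
  · exact (hm₂ _ (by omega)).symm
  · simp
  · refine hL.congr ?_ fun j hj => ?_
    · exact (hm₂ _ (by omega)).trans (hmem₁ _ (by omega))
    · have := hLn j hj
      exact (hm₂ _ (by omega)).trans (hmem₁ _ (by omega))
  · exact fun j hj => (hmark₂ j hj).trans_le (hle₁ j hj)
  simp only [Function.update_apply, Nat.reduceEqDiff, ↓reduceIte]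
  rintro s₂ ⟨L', hsub, hF₂, h8₂, hL₂, hkeep, hlow, -, h0₂, ht₂⟩
  refine .block ?_
  simp only [opsWP, Op.Safe, Op.eval, hF₂.next, h8₂, true_and, Function.update_self,
    Function.update_of_ne, ne_eq, Nat.reduceEqDiff, not_false_eq_true]
  refine ⟨by omega, ?_⟩
  have hmem₃ : ∀ c < listStart n M n + 4 * (n + 1), Function.update (Function.update s₂.mem
      (listStart n M n + 4 * (n + 1) + (k + 1)) (s₂.mem (listStart n M n + 4 * (n + 1))))
      (listStart n M n + 4 * (n + 1)) (k + 1) c = m c := by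
    intro c hc
    rw [Function.update_of_ne (by omega), Function.update_of_ne (by omega), hlow c hc]
  have hL'k : ∀ j ∈ L', 1 ≤ j ∧ j ≤ k := fun j hj => hLk j (hsub.subset hj)
  refine ⟨?_, ?_, ?_, ?_, ?_, ?_, (k + 1) :: L', ⟨?_, hL₂.congr ?_ ?_⟩, ?_, ?_, ?_, ?_⟩
  · repeat refine Frame.update ?_ (by decide) _
    exact hF₂
  · simpa [State.tick] using h8₂
  · refine hT.congr fun c hc => ?_
    exact (hmem₃ c (by omega)).trans ((hm₂ c (by omega)).trans (hmem₁ c (by omega)))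
  · intro j hj
    exact (hmem₃ _ (by omega)).trans_le ((hmark₂ j hj).trans_le (hle₁ j hj))
  · intro j hj hj' k' hk'
    rw [← hmax₂ j hj hj' k' hk']
    exact iff_of_eq (congrArg (k' < ·) (hmem₃ (listStart n M n + 3 * (n + 1) + j) (by omega)))
  · refine Eq.trans (b := s₂.reg 0) (by simp) ?_
    simp only [h0₂, hjump, h0₁, hout]
    have : (∃ k' ≤ k + 1, 1 ≤ k' ∧ JumpAt n M pos k') ↔
        JumpAt n M pos (k + 1) ∨ ∃ k' ≤ k, 1 ≤ k' ∧ JumpAt n M pos k' := by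
      constructor
      · rintro ⟨k', h1, h2, h3⟩
        rcases Nat.le_succ_iff.1 h1 with h1 | rfl
        exacts [.inr ⟨k', h1, h2, h3⟩, .inl h3]
      · rintro (h | ⟨k', h1, h2, h3⟩)
        exacts [⟨k + 1, le_rfl, by omega, h⟩, ⟨k', by omega, h2, h3⟩]
    rw [if_congr this rfl rfl, ite_or]
  · simp
  · simp
  · intro j hj
    have := hL'k j hj
    simp only
    rw [Function.update_of_ne (by omega), Function.update_of_ne (by omega)]
  · rw [List.pairwise_cons]
    exact ⟨fun j hj => by have := hL'k j hj; omega, hdec.sublist hsub⟩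
  · intro j hj
    rcases List.mem_cons.1 hj with rfl | hj
    · omega
    · have := hL'k j hj
      omega
  · intro j hj hj' h
    rcases Nat.le_succ_iff.1 hj' with hj' | rfl
    -- A maximum above `k + 1` is above `k`, so `j` was in the old list, and the walk did not delete
    -- it.
    · refine List.mem_cons_of_mem _ (hkeep j (hmem j hj hj' ?_) ?_)
      · have h' := h.trans_eq (hmem₃ _ (by omega))
        rw [hm₂ _ (by omega), hmem₁ _ (by omega)] at h'
        omega
      · exact h.trans_eq (hmem₃ _ (by omega))
    · simp
  · rw [Finset.sum_range_succ]
    simp only [List.length_cons] at ht₂ ⊢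
    omega

/-! ### The whole program -/

/-- The program: decide whether the labeling is non-jumping. -/
def decideCmd : Cmd :=
  .seq sizeCmd (.seq tableCmd (.seq (.block [.const 8 0]) (.whileLt 8 2 visitCmd)))

/-- The labeling permutes the identifiers, so summing list lengths in the order of treatment gives
the same total as in the order of storage. -/
theorem sum_length {n : ℕ} {M pos : ℕ → ℕ} (hM : IsInput n M pos) :
    2 * n + 1 + ∑ i ∈ Finset.range n, M (n + 1 + M (i + 1)) = listStart n M n := by
  rw [listStart]
  congr 1
  refine Finset.sum_nbij' (fun i => M (i + 1)) (fun x => pos x - 1) ?_ ?_ ?_ ?_ fun _ _ => rfl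
  · intro i hi
    rw [Finset.mem_range] at hi ⊢
    exact hM.lab_lt _ (by omega) hi
  · intro x hx
    rw [Finset.mem_range] at hx ⊢
    have := hM.pos_pos x hx
    have := hM.pos_le x hx
    omega
  · intro i hi
    rw [Finset.mem_range] at hi
    rw [hM.pos_lab _ (by omega) hi]
    rfl
  · intro x hx
    rw [Finset.mem_range] at hx
    rw [Nat.sub_add_cancel (hM.pos_pos x hx), hM.lab_pos x hx]

open Classical in
theorem decideCmd_spec {n W : ℕ} {M pos : ℕ → ℕ} (hM : IsInput n M pos)
    (hW : listStart n M n + 5 * (n + 1) ≤ W) :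
    decideCmd.WP W (fun s => (s.reg 0 = if ∃ k ≤ n, 1 ≤ k ∧ JumpAt n M pos k then 0 else 1) ∧
      s.time ≤ 200 * (n + 1) + 40 * listStart n M n) ⟨fun _ => 0, M, 0⟩ := by
  refine .seq ((sizeCmd_spec hM hW).mono ?_)
  rintro s₁ ⟨h0, h1, h2, h3, hm, ht⟩
  refine .seq ((tableCmd_spec hM hW h0 h1 h2 h3 hm ht).mono ?_)
  rintro s₂ ⟨h0, hF, hT, hz, ht⟩
  refine .seq (.block ⟨Nat.zero_le _, ?_⟩)
  refine .while_induction (Invariant n M pos) n (Nat.zero_le n) ?_ ?_ ?_ ?_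
  -- Untouched memory is `0`: no position is stamped, and the head cell represents the empty list.
  · refine ⟨hF.update (by decide) _, by simp [Op.eval], hT, fun j hj => (hz _ (by omega)).le, ?_, ?_,
      [], hz _ (by omega), by simp, by simp, ?_, ?_⟩
    · intro j hj hj'
      omega
    · rw [if_neg]
      · simpa [Op.eval] using h0
      · rintro ⟨k, h1, h2, -⟩
        omega
    · intro j hj hj'
      omega
    · simp only [Op.eval, List.length_nil, Finset.sum_range_zero]
      omega
  · intro i s hs
    rw [hs.frame.size, hs.counter]
  · exact fun i s hi hs => visitCmd_spec hM hW hi hs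
  · intro s hs
    refine ⟨hs.out, ?_⟩
    obtain ⟨L, -, -, -, -, h⟩ := hs.list
    have := sum_length hM
    simp only [State.tick]
    omega

end RAM

/-! ### The encoded input, and translation back to the graph -/

theorem getElem?_flatten_map_range (f : ℕ → List ℕ) {n x r : ℕ} (hx : x < n)
    (hr : r < (f x).length) :
    ((List.range n).map f).flatten[∑ y ∈ Finset.range x, (f y).length + r]? = (f x)[r]? := by
  have hlen : ∀ n, ((List.range n).map f).flatten.length = ∑ y ∈ Finset.range n, (f y).length := by
    intro n
    induction n with
    | zero => simp
    | succ n ih =>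
      rw [List.range_succ, List.map_append, List.flatten_append, List.length_append, ih,
        Finset.sum_range_succ]
      simp
  induction n with
  | zero => omega
  | succ n ih =>
    rw [List.range_succ, List.map_append, List.flatten_append]
    rcases Nat.lt_succ_iff_lt_or_eq.1 hx with h | rfl
    · rw [List.getElem?_append_left, ih h]
      rw [hlen]
      have h1 : ∑ y ∈ Finset.range (x + 1), (f y).length ≤ ∑ y ∈ Finset.range n, (f y).length :=
        Finset.sum_le_sum_of_subset (Finset.range_mono h)
      rw [Finset.sum_range_succ] at h1
      omega
    · rw [List.getElem?_append_right (by rw [hlen]; omega), hlen, Nat.add_sub_cancel_left]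
      simp

theorem getElem?_flatten_ofFn {n : ℕ} (f : Fin n → List ℕ) (x : Fin n) {r : ℕ}
    (hr : r < (f x).length) :
    (List.ofFn f).flatten[∑ y ∈ Finset.range x, (if h : y < n then (f ⟨y, h⟩).length else 0) + r]? =
      (f x)[r]? := by
  have h := getElem?_flatten_map_range (fun y => if h : y < n then f ⟨y, h⟩ else []) x.2
    (r := r) (by simpa using hr)
  have h1 : (List.range n).map (fun y => if h : y < n then f ⟨y, h⟩ else []) = List.ofFn f := by
    refine List.ext_getElem (by simp) fun i h1 h2 => ?_
    have : i < n := by simpa using h2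
    simp [this]
  rw [h1] at h
  simp only [x.2, dite_true] at h
  rw [← h]
  congr 3 with y
  split_ifs <;> rfl

section Encode

variable {V : Type u} {n : ℕ} {G : SimpleGraph V} {name γ : Fin n ≃ V} {adj : V → List V}

/-- The memory cells holding the encoded input. -/
def inputMem (name γ : Fin n ≃ V) (adj : V → List V) (a : ℕ) : ℕ :=
  (encodeInput name γ adj).getD a 0

/-- The position in the labeling, counted from `1`, of the vertex with identifier `x`. -/
def labelPos (name γ : Fin n ≃ V) (x : ℕ) : ℕ :=
  if h : x < n then γ.symm (name ⟨x, h⟩) + 1 else 0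

theorem inputMem_zero : inputMem name γ adj 0 = n := by
  simp [inputMem, encodeInput]

theorem inputMem_label (i : Fin n) : inputMem name γ adj (i + 1) = name.symm (γ i) := by
  simp [inputMem, encodeInput, List.getElem?_append]

theorem inputMem_length (x : Fin n) :
    inputMem name γ adj (n + 1 + x) = (adj (name x)).length := by
  have h : n + 1 + (x : ℕ) = n + x + 1 := by omega
  simp [inputMem, encodeInput, List.getElem?_append, h]

theorem listStart_inputMem {x : ℕ} (hx : x ≤ n) : RAM.listStart n (inputMem name γ adj) x =
    2 * n + 1 + ∑ y ∈ Finset.range x, if h : y < n then (adj (name ⟨y, h⟩)).length else 0 := by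
  rw [RAM.listStart]
  congr 1
  refine Finset.sum_congr rfl fun y hy => ?_
  have hy' : y < n := (Finset.mem_range.1 hy).trans_le hx
  rw [dif_pos hy']
  exact inputMem_length ⟨y, hy'⟩

theorem inputMem_entry (x : Fin n) {r : ℕ} (hr : r < (adj (name x)).length) :
    inputMem name γ adj (RAM.listStart n (inputMem name γ adj) x + r) =
      name.symm ((adj (name x))[r]) := by
  have h := getElem?_flatten_ofFn (fun x => (adj (name x)).map fun w => (name.symm w : ℕ)) x
    (r := r) (by simpa using hr)
  simp only [List.length_map] at h
  rw [listStart_inputMem x.2.le, inputMem, encodeInput, List.getD_eq_getElem?_getD,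
    List.getElem?_append_right]
  · simp only [List.length_append, List.length_cons, List.length_nil, List.length_ofFn]
    rw [show ∀ S : ℕ, 2 * n + 1 + S + r - (0 + 1 + n + n) = S + r by intro S; omega, h]
    simp [hr]
  · simp
    omega

theorem exists_listStart_le (M : ℕ → ℕ) {a N : ℕ} (ha : 2 * n + 1 ≤ a)
    (ha' : a < RAM.listStart n M N) :
    ∃ x < N, RAM.listStart n M x ≤ a ∧ a < RAM.listStart n M x + M (n + 1 + x) := by
  induction N with
  | zero => simp [RAM.listStart] at ha'; omega
  | succ N ih =>
    by_cases h : a < RAM.listStart n M N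
    · obtain ⟨x, hx, h'⟩ := ih h
      exact ⟨x, by omega, h'⟩
    · exact ⟨N, by omega, by omega, by rwa [RAM.listStart_succ] at ha'⟩

theorem listStart_eq_length :
    RAM.listStart n (inputMem name γ adj) n = (encodeInput name γ adj).length := by
  rw [listStart_inputMem le_rfl, Finset.sum_range]
  simp [encodeInput, List.length_flatten, List.map_ofFn, List.sum_ofFn, Function.comp_def]
  omega

theorem isInput_inputMem : RAM.IsInput n (inputMem name γ adj) (labelPos name γ) where
  size := inputMem_zero
  lab_lt k hk hk' := by
    have := inputMem_label (name := name) (γ := γ) (adj := adj) ⟨k - 1, by omega⟩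
    simp only [Nat.sub_add_cancel hk] at this
    rw [this]
    exact Fin.isLt _
  pos_lab k hk hk' := by
    have := inputMem_label (name := name) (γ := γ) (adj := adj) ⟨k - 1, by omega⟩
    simp only [Nat.sub_add_cancel hk] at this
    rw [this]
    simp [labelPos, hk]
  pos_pos x hx := by simp [labelPos, hx]
  pos_le x hx := by simp only [labelPos, hx, dite_true]; omega
  lab_pos x hx := by
    simp only [labelPos, hx, dite_true]
    rw [inputMem_label]
    simp
  entry_lt a ha ha' := by
    obtain ⟨x, hx, h1, h2⟩ := exists_listStart_le _ ha ha'
    obtain ⟨r, rfl⟩ := Nat.exists_eq_add_of_le h1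
    have h3 := inputMem_length (name := name) (γ := γ) (adj := adj) ⟨x, hx⟩
    simp only at h3
    rw [inputMem_entry ⟨x, hx⟩ (by omega)]
    exact Fin.isLt _
  eq_zero a ha := by
    rw [listStart_eq_length] at ha
    simp [inputMem, ha]

theorem posAdj_inputMem (hadj : IsAdjacencyList G adj) (k : Fin n) (p : ℕ) :
    RAM.PosAdj n (inputMem name γ adj) (labelPos name γ) (k + 1) p ↔
      ∃ i : Fin n, (i : ℕ) + 1 = p ∧ G.Adj (γ k) (γ i) := by
  rw [RAM.PosAdj, inputMem_label, inputMem_length]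
  have hpos : ∀ w, labelPos name γ (name.symm w) = γ.symm w + 1 := fun w => by simp [labelPos]
  constructor
  · rintro ⟨a, h1, h2, h3⟩
    obtain ⟨r, rfl⟩ := Nat.exists_eq_add_of_le h1
    have hr : r < (adj (name (name.symm (γ k)))).length := by omega
    rw [inputMem_entry _ hr, hpos] at h3
    refine ⟨_, h3, ?_⟩
    have := List.getElem_mem hr
    rw [(hadj _).2] at this
    simpa using this
  · rintro ⟨i, rfl, h⟩
    have h' : γ i ∈ adj (name (name.symm (γ k))) := by
      rw [(hadj _).2]
      simpa using h
    obtain ⟨r, hr, hri⟩ := List.getElem_of_mem h'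
    refine ⟨_, Nat.le_add_right _ r, by omega, ?_⟩
    rw [inputMem_entry _ hr, hri, hpos, Equiv.symm_apply_apply]

/-- The machine counts positions from `1`, the labeling from `0`; apart from this shift and the
symmetry of adjacency, a jump is a counterexample to the defining condition. -/
theorem exists_jumpAt_iff (hadj : IsAdjacencyList G adj) :
    (∃ k ≤ n, 1 ≤ k ∧ RAM.JumpAt n (inputMem name γ adj) (labelPos name γ) k) ↔
      ¬ IsNonJumpingLabeling G γ := by
  simp only [IsNonJumpingLabeling, not_forall]
  constructor
  · rintro ⟨k, hk, hk', i, j, l, hij, hjk, hkl, h1, h2, h3⟩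
    obtain ⟨k, rfl⟩ := Nat.exists_eq_add_of_le' hk'
    obtain ⟨j, rfl⟩ := Nat.exists_eq_add_of_le' (show 1 ≤ j by omega)
    rw [show k = ((⟨k, hk⟩ : Fin n) : ℕ) from rfl, posAdj_inputMem hadj] at h1 h3
    rw [show j = ((⟨j, by omega⟩ : Fin n) : ℕ) from rfl, posAdj_inputMem hadj] at h2
    obtain ⟨i, rfl, h1⟩ := h1
    obtain ⟨l, rfl, h2⟩ := h2
    refine ⟨i, ⟨j, by omega⟩, ⟨k, hk⟩, l, ?_, ?_, ?_, h1.symm, h2, fun h => h3 ⟨_, rfl, h.symm⟩⟩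
    · exact Fin.lt_def.2 (by simpa using hij)
    · exact Fin.lt_def.2 (by simpa using hjk)
    · exact Fin.lt_def.2 (by simpa using hkl)
  · rintro ⟨i, j, k, l, hij, hjk, hkl, h1, h2, h3⟩
    rw [Fin.lt_def] at hij hjk hkl
    refine ⟨k + 1, k.2, by omega, i + 1, j + 1, l + 1, by omega, by omega, by omega, ?_, ?_, ?_⟩
    · exact (posAdj_inputMem hadj _ _).2 ⟨i, rfl, h1.symm⟩
    · exact (posAdj_inputMem hadj _ _).2 ⟨l, rfl, h2⟩
    · rw [posAdj_inputMem hadj]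
      rintro ⟨j', h, h'⟩
      obtain rfl : j' = j := Fin.ext (by omega)
      exact h3 h'.symm

theorem IsAdjacencyList.length_le (hadj : IsAdjacencyList G adj) (name : Fin n ≃ V) (v : V) :
    (adj v).length ≤ n := by
  classical
  let _ := Fintype.ofEquiv _ name
  refine ((hadj v).1.length_le_card).trans_eq ?_
  rw [← Fintype.card_congr name, Fintype.card_fin]

/-- The list lengths are the degrees, so this is the handshake lemma. -/
theorem listStart_eq (hadj : IsAdjacencyList G adj) :
    RAM.listStart n (inputMem name γ adj) n = 2 * n + 1 + 2 * G.edgeSet.ncard := by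
  classical
  let _ := Fintype.ofEquiv _ name
  rw [listStart_inputMem le_rfl, Finset.sum_range]
  simp only [Fin.is_lt, dite_true, Fin.eta]
  rw [Equiv.sum_comp name fun v => (adj v).length, Set.ncard_eq_toFinset_card', Set.toFinset_card,
    ← SimpleGraph.edgeFinset_card, ← SimpleGraph.sum_degrees_eq_twice_card_edges]
  congr 1
  refine Finset.sum_congr rfl fun v _ => ?_
  rw [← SimpleGraph.card_neighborFinset_eq_degree, ← List.toFinset_card_of_nodup (hadj v).1]
  congr 1
  ext w
  simp [(hadj v).2]

theorem listStart_le (hadj : IsAdjacencyList G adj) :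
    RAM.listStart n (inputMem name γ adj) n ≤ 2 * n + 1 + n * n := by
  rw [listStart_inputMem le_rfl]
  have h : ∀ y ∈ Finset.range n, (if h : y < n then (adj (name ⟨y, h⟩)).length else 0) ≤ n := by
    intro y _
    split_ifs
    exacts [hadj.length_le name _, Nat.zero_le n]
  have := Finset.sum_le_card_nsmul _ _ _ h
  rw [Finset.card_range, smul_eq_mul] at this
  omega

theorem le_of_mem_encodeInput (hadj : IsAdjacencyList G adj) {x : ℕ}
    (hx : x ∈ encodeInput name γ adj) : x ≤ n := by
  simp only [encodeInput, List.mem_append, List.mem_singleton, List.mem_ofFn, List.mem_flatten]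
    at hx
  rcases hx with ((rfl | ⟨i, rfl⟩) | ⟨i, rfl⟩) | ⟨l, ⟨i, rfl⟩, hx⟩
  · exact le_rfl
  · exact (Fin.isLt _).le
  · exact hadj.length_le name _
  · obtain ⟨w, -, rfl⟩ := List.mem_map.1 hx
    exact (Fin.isLt _).le

end Encode

/-! ### Constants and conclusion -/

theorem add_le_pow (n : ℕ) {C : ℕ} (hC : 4 ≤ C) :
    2 * n + 1 + n * n + 5 * (n + 1) ≤ (n + 2) ^ C :=
  calc 2 * n + 1 + n * n + 5 * (n + 1) ≤ (n + 2) ^ 4 := by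
        nlinarith [Nat.zero_le (n ^ 4), Nat.zero_le (n ^ 3), Nat.zero_le (n ^ 2)]
    _ ≤ (n + 2) ^ C := Nat.pow_le_pow_right (Nat.succ_pos _) hC

theorem mainTheorem11 :
    ∃ (p : RAM.Program) (C : ℕ),
      ∀ (V : Type u) (n : ℕ) (G : SimpleGraph V) (name γ : Fin n ≃ V) (adj : V → List V),
        IsAdjacencyList G adj →
        ∃ t : ℕ,
          (t : ℝ) ≤ C * (n * Real.log n + G.edgeSet.ncard + 1) ∧
          (IsNonJumpingLabeling G γ →
            RAM.Computes p (encodeInput name γ adj) 1 t ((n + 2) ^ C)) ∧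
          (¬ IsNonJumpingLabeling G γ →
            RAM.Computes p (encodeInput name γ adj) 0 t ((n + 2) ^ C)) := by
  -- The time is at most `280 n + 240 + 80 m`; replacing `n` by `n log n + 1` makes the additive
  -- constant `280 + 240 = 520`.
  refine ⟨RAM.decideCmd.code 0, 520, fun V n G name γ adj hadj => ?_⟩
  have hsmall := add_le_pow n (show 4 ≤ 520 by omega)
  -- Only `hsmall` is needed about the word bound, so the huge power is hidden.
  generalize (n + 2) ^ 520 = W at hsmall ⊢
  have hW : RAM.listStart n (inputMem name γ adj) n + 5 * (n + 1) ≤ W := by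
    have := listStart_le (name := name) (γ := γ) hadj
    omega
  have hspec := RAM.decideCmd_spec isInput_inputMem hW
  obtain ⟨s, ⟨hout, ht⟩, hs⟩ := RAM.Cmd.WP.computes (input := encodeInput name γ adj)
    (fun x hx => (le_of_mem_encodeInput hadj hx).trans (by omega)) hspec
  refine ⟨s.time, ?_, fun h => ?_, fun h => ?_⟩
  · rw [listStart_eq hadj] at ht
    have ht' : (s.time : ℝ) ≤ 280 * n + 240 + 80 * G.edgeSet.ncard := by
      exact_mod_cast (show s.time ≤ 280 * n + 240 + 80 * G.edgeSet.ncard by omega)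
    have hlog : (n : ℝ) ≤ n * Real.log n + 1 := by
      rcases Nat.eq_zero_or_pos n with rfl | hn
      · simp
      · have hn' : (0 : ℝ) < n := Nat.cast_pos.2 hn
        -- Multiplying `1 - 1/n ≤ log n` by `n` gives `n - 1 ≤ n log n`.
        have h1 := Real.one_sub_inv_le_log_of_pos hn'
        have h2 := mul_le_mul_of_nonneg_left h1 hn'.le
        rw [mul_sub, mul_inv_cancel₀ hn'.ne'] at h2
        linarith
    have hm : (0 : ℝ) ≤ G.edgeSet.ncard := Nat.cast_nonneg _
    have hlog0 : (0 : ℝ) ≤ n * Real.log n :=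
      mul_nonneg (Nat.cast_nonneg _) (Real.log_natCast_nonneg n)
    push_cast
    linarith
  · rw [if_neg fun h' => (exists_jumpAt_iff hadj).1 h' h] at hout
    rwa [hout] at hs
  · rw [if_pos ((exists_jumpAt_iff hadj).2 h)] at hout
    rwa [hout] at hs
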